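/- Let $F$ be the free group of rank two, $M=F/F''$ the free metabelian group of rank two, and $\widehat{M}$ its profinite completion. Let $\widehat{M}'$ be its (closed) derived subgroup and $\widehat{A}=\widehat{M}/\widehat{M}'$ its abelianization. Let $$\Lambda=\widehat{\mathbb{Z}}[[\widehat{A}]]=\varprojlim_{n,U}(\mathbb{Z}/n)[\widehat{A}/U]$$ ($n\ge 1$, $U\le\widehat{A}$ open) be the completed group algebra, and let $\varepsilon:\Lambda\to\widehat{\mathbb{Z}}$ be the augmentation, induced by $a\mapsto 1$ for $a\in\widehat{A}$. An element $b\in\Lambda$ is special if $\varepsilon(b)=1$; a special unit is a unit of $\Lambda$ that is special. The abelian group $\widehat{M}'$ is a $\Lambda$-module through the unique continuous action, written $m\mapsto m^{r}$ for $r\in\Lambda$, that extends the conjugation action $m^{a}=\tilde a m\tilde a^{-1}$, where $\tilde a\in\widehat{M}$ is any lift of $a\in\widehat{A}$. Let $x_1,x_2$ be topological generators of $\widehat{M}$, with images $a_1,a_2\in\widehat{A}$, and write $[x_1,x_2]=x_1x_2x_1^{-1}x_2^{-1}$. For $r=(r_1,r_2)\in\Lambda^2$ let $\gamma_r$ be the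 unique continuous endomorphism of $\widehat{M}$ with $\gamma_r(x_i)=[x_1,x_2]^{r_i}x_i$ for $i=1,2$; it is an IA-endomorphism, i.e. it induces the identity on $\widehat{A}$. Let $\widehat{T}$ be the free $\Lambda$-module on $t_1,t_2$, and let $\mu:\widehat{M}\to\widehat{T}\rtimes\widehat{A}$ be the continuous homomorphism with $\mu(x_i)=(t_i,a_i)$. For an IA-endomorphism $\gamma$ let $\beta(\gamma)$ be the $\Lambda$-linear endomorphism of $\widehat{T}$ with $\mu(\gamma(x_i))=(\beta(\gamma)(t_i),a_i)$, and let $\det(\gamma):=\det(\beta(\gamma))\in\Lambda$ be its Bachmuth determinant. Then: 1. for every $r\in\Lambda^2$, $\det(\gamma_r)=1+r_1(1-a_2)+r_2(a_1-1)$; 2. for every $r\in\Lambda^2$, $\gamma_r$ is an automorphism of $\widehat{M}$ if and only if $\det(\gamma_r)$ is a special unit of $\Lambda$; 3. the image of the map $\Lambda^2\to\Lambda$, $r\mapsto\det(\gamma_r)$, is exactly the set of special elements of $\Lambda$. -/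

import Mathlib

open scoped commutatorElement

namespace ProMetabelian

/-- The free metabelian group `M = F / F''` of rank two. -/
abbrev FreeMetab : Type := FreeGroup (Fin 2) ⧸ derivedSeries (FreeGroup (Fin 2)) 2

/-- The profinite completion `M̂` of the free metabelian group of rank two. -/
abbrev Mhat : Type := ProfiniteGrp.ProfiniteCompletion.completion (GrpCat.of FreeMetab)

/-- The closed derived subgroup `M̂'`. -/
abbrev Mder : Subgroup Mhat := (commutator Mhat).topologicalClosure

/-- The abelianization `Â` of the profinite group `M̂`. -/
abbrev Ahat : Type := TopologicalAbelianization Mhat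

theorem isClosed_mder : IsClosed (Mder : Set Mhat) := Subgroup.isClosed_topologicalClosure _

instance : CompactSpace Mder := isCompact_iff_compactSpace.mp isClosed_mder.isCompact

instance : T2Space Ahat :=
  have := isClosed_mder
  have : T3Space Ahat := QuotientGroup.instT3Space (commutator Mhat).topologicalClosure
  inferInstance

instance : TotallyDisconnectedSpace Ahat := by
  suffices TotallySeparatedSpace Ahat from inferInstance
  refine totallySeparatedSpace_iff_exists_isClopen.mpr fun a b hab => ?_
  obtain ⟨a, rfl⟩ := QuotientGroup.mk_surjective a
  obtain ⟨b, rfl⟩ := QuotientGroup.mk_surjective b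
  have h1 : a⁻¹ * b ∉ Mder := fun h => hab (QuotientGroup.eq.mpr h)
  have h2 := ProfiniteGrp.closedSubgroup_eq_sInf_open (⟨Mder, isClosed_mder⟩ : ClosedSubgroup Mhat)
  have h3 : a⁻¹ * b ∉ sInf {N : Subgroup Mhat | IsOpen (N : Set Mhat) ∧ Mder ≤ N} := by
    rw [← h2]; exact h1
  simp only [Subgroup.mem_sInf, not_forall] at h3
  obtain ⟨N, ⟨hN, hle⟩, hmem⟩ := h3
  let mk : Mhat →* Ahat := QuotientGroup.mk' Mder
  have hopen : IsOpen ((N.map mk : Subgroup Ahat) : Set Ahat) :=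
    QuotientGroup.isOpenMap_coe _ hN
  have hmem' : ∀ g : Mhat, mk g ∈ N.map mk → g ∈ N := by
    rintro g ⟨n, hn, hng⟩
    have h4 : n⁻¹ * g ∈ Mder := QuotientGroup.eq.mp hng
    have h5 := N.mul_mem hn (hle h4)
    simpa using h5
  let U : OpenSubgroup Ahat := ⟨N.map mk, hopen⟩
  refine ⟨(fun c => (mk a)⁻¹ * c) ⁻¹' (U : Set Ahat), U.isClopen.preimage (by fun_prop), ?_, ?_⟩
  · change (mk a)⁻¹ * mk a ∈ U
    rw [inv_mul_cancel]
    exact U.one_mem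
  · intro h
    apply hmem
    apply hmem'
    rw [map_mul, map_inv]
    exact h

/-- The images in `M̂` of the standard generators of the free group. -/
def stdGen (i : Fin 2) : Mhat :=
  ProfiniteGrp.ProfiniteCompletion.etaFn (GrpCat.of FreeMetab)
    (QuotientGroup.mk (FreeGroup.of i) : FreeMetab)

theorem freeMetab_law (a b c d : FreeMetab) : ⁅⁅a, b⁆, ⁅c, d⁆⁆ = 1 := by
  obtain ⟨a, rfl⟩ := QuotientGroup.mk_surjective a
  obtain ⟨b, rfl⟩ := QuotientGroup.mk_surjective b
  obtain ⟨c, rfl⟩ := QuotientGroup.mk_surjective c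
  obtain ⟨d, rfl⟩ := QuotientGroup.mk_surjective d
  have : ⁅⁅a, b⁆, ⁅c, d⁆⁆ ∈ derivedSeries (FreeGroup (Fin 2)) 2 := by
    rw [derivedSeries_succ, derivedSeries_one]
    exact Subgroup.commutator_mem_commutator
      (Subgroup.commutator_mem_commutator trivial trivial)
      (Subgroup.commutator_mem_commutator trivial trivial)
  exact (QuotientGroup.eq_one_iff _).mpr this

theorem mhat_law (a b c d : Mhat) : ⁅⁅a, b⁆, ⁅c, d⁆⁆ = 1 := by
  apply Subtype.ext
  funext N
  obtain ⟨a', ha⟩ := QuotientGroup.mk_surjective (a.1 N)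
  obtain ⟨b', hb⟩ := QuotientGroup.mk_surjective (b.1 N)
  obtain ⟨c', hc⟩ := QuotientGroup.mk_surjective (c.1 N)
  obtain ⟨d', hd⟩ := QuotientGroup.mk_surjective (d.1 N)
  change ⁅⁅a.1 N, b.1 N⁆, ⁅c.1 N, d.1 N⁆⁆ = 1
  rw [← ha, ← hb, ← hc, ← hd]
  exact congrArg (QuotientGroup.mk' N.toSubgroup) (freeMetab_law a' b' c' d')

theorem commutator_comm {H : Type} [Group H] (hH : ∀ a b c d : H, ⁅⁅a, b⁆, ⁅c, d⁆⁆ = 1) :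
    ∀ u ∈ commutator H, ∀ v ∈ commutator H, u * v = v * u := by
  intro u hu v hv
  rw [commutator_eq_closure] at hu hv
  have := Subgroup.isMulCommutative_closure (k := commutatorSet H) (by
    rintro _ ⟨a, b, rfl⟩ _ ⟨c, d, rfl⟩
    exact commutatorElement_eq_one_iff_mul_comm.mp (hH a b c d))
  exact setLike_mul_comm hu hv

theorem mder_comm : ∀ u ∈ Mder, ∀ v ∈ Mder, u * v = v * u := by
  intro u hu v hv
  exact congrArg Subtype.val (((commutator Mhat).commGroupTopologicalClosure
    (fun x y => Subtype.ext (commutator_comm mhat_law x x.2 y y.2))).mul_comm ⟨u, hu⟩ ⟨v, hv⟩)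

/-- Homomorphisms to a metabelian group kill the second derived subgroup. -/
theorem derivedSeries_two_le_ker {H : Type} [Group H] (hH : ∀ a b c d : H, ⁅⁅a, b⁆, ⁅c, d⁆⁆ = 1)
    (f : FreeGroup (Fin 2) →* H) : derivedSeries (FreeGroup (Fin 2)) 2 ≤ f.ker := by
  intro w hw
  have h1 := map_derivedSeries_le_derivedSeries f 2 (Subgroup.mem_map_of_mem f hw)
  have h2 : derivedSeries H 2 ≤ ⊥ := by
    rw [derivedSeries_succ, derivedSeries_one, Subgroup.commutator_le]
    intro u hu v hv
    exact commutatorElement_eq_one_iff_mul_comm.mpr (commutator_comm hH u hu v hv)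
  exact h2 h1

/-- The pair `x` generates the profinite group `M̂` topologically. -/
def Generates (x : Fin 2 → Mhat) : Prop :=
  (Subgroup.closure (Set.range x)).topologicalClosure = ⊤

section Universal

variable {H : Type} [Group H] [TopologicalSpace H]

theorem eq_of_eq_on_gen [T2Space H] {x : Fin 2 → Mhat} (hx : Generates x) {f g : Mhat →ₜ* H}
    (h : ∀ i, f (x i) = g (x i)) : f = g := by
  have h1 : Subgroup.closure (Set.range x) ≤ (f : Mhat →* H).eqLocus (g : Mhat →* H) := by
    rw [Subgroup.closure_le]
    rintro _ ⟨i, rfl⟩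
    exact h i
  have h2 : (Subgroup.closure (Set.range x)).topologicalClosure
      ≤ (f : Mhat →* H).eqLocus (g : Mhat →* H) :=
    Subgroup.topologicalClosure_minimal _ h1
      (isClosed_eq (map_continuous f) (map_continuous g))
  rw [hx] at h2
  ext a
  exact h2 (Subgroup.mem_top a)

theorem generates_stdGen : Generates stdGen := by
  have hd : DenseRange (ProfiniteGrp.ProfiniteCompletion.etaFn (GrpCat.of FreeMetab)) :=
    ProfiniteGrp.ProfiniteCompletion.denseRange _
  let η : FreeMetab →* Mhat := (ProfiniteGrp.ProfiniteCompletion.eta (GrpCat.of FreeMetab)).hom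
  let ψ : FreeGroup (Fin 2) →* Mhat := η.comp (QuotientGroup.mk' _)
  have h1 : ψ.range ≤ Subgroup.closure (Set.range stdGen) := by
    rw [MonoidHom.range_eq_map, ← FreeGroup.closure_range_of, MonoidHom.map_closure,
      ← Set.range_comp]
    rfl
  have h2 : Set.range (ProfiniteGrp.ProfiniteCompletion.etaFn (GrpCat.of FreeMetab)) ⊆
      (Subgroup.closure (Set.range stdGen) : Set Mhat) := by
    rintro _ ⟨m, rfl⟩
    obtain ⟨w, rfl⟩ := QuotientGroup.mk_surjective (s := derivedSeries (FreeGroup (Fin 2)) 2) m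
    exact h1 ⟨w, rfl⟩
  refine SetLike.coe_injective ?_
  rw [Subgroup.topologicalClosure_coe]
  exact (hd.mono h2).closure_eq

theorem exists_lift_std [IsTopologicalGroup H] [CompactSpace H] [TotallyDisconnectedSpace H]
    (hH : ∀ a b c d : H, ⁅⁅a, b⁆, ⁅c, d⁆⁆ = 1) (y : Fin 2 → H) :
    ∃ f : Mhat →ₜ* H, ∀ i, f (stdGen i) = y i := by
  let f₀ : FreeGroup (Fin 2) →* H := FreeGroup.lift y
  let f₁ : FreeMetab →* H := QuotientGroup.lift _ f₀ (derivedSeries_two_le_ker hH f₀)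
  let f₂ : GrpCat.of FreeMetab ⟶ GrpCat.of (ProfiniteGrp.of H) := GrpCat.ofHom f₁
  refine ⟨(ProfiniteGrp.ProfiniteCompletion.lift f₂).hom, fun i => ?_⟩
  have := congrArg (fun g => g.hom (QuotientGroup.mk (FreeGroup.of i) : FreeMetab))
    (ProfiniteGrp.ProfiniteCompletion.lift_eta f₂)
  refine Eq.trans this ?_
  change f₀ (FreeGroup.of i) = y i
  simp [f₀]

/-- Two topological generators of `M̂` form a basis. -/
theorem exists_equiv_of_generates {x : Fin 2 → Mhat} (hx : Generates x) :
    ∃ e : Mhat ≃ₜ* Mhat, ∀ i, e (stdGen i) = x i := by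
  obtain ⟨φ, hφ⟩ := exists_lift_std mhat_law x
  have hsurj : Function.Surjective φ := by
    have h1 : Subgroup.closure (Set.range x) ≤ (φ : Mhat →* Mhat).range := by
      rw [Subgroup.closure_le]
      rintro _ ⟨i, rfl⟩
      exact ⟨stdGen i, hφ i⟩
    have h2 := Subgroup.topologicalClosure_minimal _ h1
      (isCompact_range (map_continuous φ)).isClosed
    rw [hx] at h2
    exact fun g => h2 (Subgroup.mem_top g)
  have hinj : Function.Injective φ := by
    refine (injective_iff_map_eq_one φ).mpr fun g hg => ?_
    by_contra hne
    obtain ⟨N, hN⟩ := ProfiniteGrp.exist_openNormalSubgroup_sub_open_nhds_of_one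
      (isOpen_compl_singleton (x := g)) (Ne.symm hne)
    let Q := Mhat ⧸ N.toSubgroup
    have : DiscreteTopology Q := QuotientGroup.discreteTopology N.isOpen'
    have : Finite Q := Subgroup.quotient_finite_of_isOpen _ N.isOpen'
    have : Finite (Mhat →ₜ* Q) := by
      refine Finite.of_injective (fun f (i : Fin 2) => f (stdGen i)) fun f f' h => ?_
      exact eq_of_eq_on_gen generates_stdGen (congrFun h)
    have h1 : Function.Injective (fun f : Mhat →ₜ* Q => f.comp φ) := by
      intro f f' h
      ext a
      obtain ⟨a, rfl⟩ := hsurj a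
      exact congrArg (fun k : Mhat →ₜ* Q => k a) h
    obtain ⟨f, hf⟩ := Finite.surjective_of_injective h1
      (⟨QuotientGroup.mk' N.toSubgroup, continuous_quotient_mk'⟩ : Mhat →ₜ* Q)
    have h2 : (QuotientGroup.mk g : Q) = 1 := by
      have := congrArg (fun k : Mhat →ₜ* Q => k g) hf
      refine this.symm.trans ?_
      change f (φ g) = 1
      rw [hg, map_one]
    exact hN ((QuotientGroup.eq_one_iff g).mp h2) rfl
  let e₀ : Mhat ≃* Mhat := MulEquiv.ofBijective φ ⟨hinj, hsurj⟩
  have hc : Continuous e₀.toEquiv := map_continuous φ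
  exact ⟨{ e₀ with
    continuous_toFun := hc
    continuous_invFun := hc.continuous_symm_of_equiv_compact_to_t2 }, hφ⟩

theorem exists_lift [IsTopologicalGroup H] [CompactSpace H] [TotallyDisconnectedSpace H]
    (hH : ∀ a b c d : H, ⁅⁅a, b⁆, ⁅c, d⁆⁆ = 1) {x : Fin 2 → Mhat} (hx : Generates x)
    (y : Fin 2 → H) : ∃ f : Mhat →ₜ* H, ∀ i, f (x i) = y i := by
  obtain ⟨e, he⟩ := exists_equiv_of_generates hx
  obtain ⟨f, hf⟩ := exists_lift_std hH y
  refine ⟨f.comp (e.symm : Mhat →ₜ* Mhat), fun i => ?_⟩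
  rw [← hf i, ← he i]
  simp

end Universal

section CompletedGroupAlgebra

variable (Q : Type) [CommGroup Q] [TopologicalSpace Q]

/-- The ring `(ℤ/n)[Q/U]`, for an open subgroup `U` (automatically normal) of the commutative
group `Q`. -/
abbrev Level (n : ℕ+) (U : OpenSubgroup Q) : Type :=
  MonoidAlgebra (ZMod (n : ℕ)) (Q ⧸ (U : Subgroup Q))

/-- The finite rings `(ℤ/n)[Q/U]` are discrete. -/
instance (n : ℕ+) (U : OpenSubgroup Q) : TopologicalSpace (Level Q n U) := ⊥

instance (n : ℕ+) (U : OpenSubgroup Q) : DiscreteTopology (Level Q n U) := ⟨rfl⟩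

variable {Q}

/-- The transition map `(ℤ/n)[Q/U] → (ℤ/n')[Q/U']` for `n' ∣ n` and `U ≤ U'`. -/
noncomputable def transition {n n' : ℕ+} {U U' : OpenSubgroup Q} (hn : (n' : ℕ) ∣ n) (hU : U ≤ U') :
    Level Q n U →+* Level Q n' U' :=
  (MonoidAlgebra.mapRingHom (Q ⧸ (U' : Subgroup Q)) (ZMod.castHom hn (ZMod (n' : ℕ)))).comp
    (MonoidAlgebra.mapDomainRingHom (ZMod (n : ℕ))
      (QuotientGroup.map (U : Subgroup Q) (U' : Subgroup Q) (MonoidHom.id Q) hU))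

variable (Q)

/-- The completed group algebra `Ẑ⟦Q⟧ = lim (ℤ/n)[Q/U]`, over all `n ≥ 1` and all open subgroups
`U` of `Q`, as the ring of compatible families. -/
def CGA : Subring (∀ p : ℕ+ × OpenSubgroup Q, Level Q p.1 p.2) where
  carrier := {r | ∀ (n n' : ℕ+) (U U' : OpenSubgroup Q) (hn : (n' : ℕ) ∣ n) (hU : U ≤ U'),
    transition hn hU (r (n, U)) = r (n', U')}
  mul_mem' hr hs n n' U U' hn hU := by simp [hr n n' U U' hn hU, hs n n' U U' hn hU]
  one_mem' n n' U U' hn hU := by simp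
  add_mem' hr hs n n' U U' hn hU := by simp [hr n n' U U' hn hU, hs n n' U U' hn hU]
  zero_mem' n n' U U' hn hU := by simp
  neg_mem' hr n n' U U' hn hU := by simp [hr n n' U U' hn hU]


/-- The profinite integers `Ẑ = lim ℤ/n`. -/
def ZHat : Subring (∀ n : ℕ+, ZMod (n : ℕ)) where
  carrier := {u | ∀ (n n' : ℕ+) (hn : (n' : ℕ) ∣ n),
    ZMod.castHom hn (ZMod (n' : ℕ)) (u n) = u n'}
  mul_mem' hr hs n n' hn := by
    simp only [Pi.mul_apply, map_mul, hr n n' hn, hs n n' hn]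
  one_mem' n n' hn := by simp only [Pi.one_apply, map_one]
  add_mem' hr hs n n' hn := by
    simp only [Pi.add_apply, map_add, hr n n' hn, hs n n' hn]
  zero_mem' n n' hn := by simp only [Pi.zero_apply, map_zero]
  neg_mem' hr n n' hn := by simp only [Pi.neg_apply, map_neg, hr n n' hn]

variable {Q}

/-- The augmentation `(ℤ/n)[Q/U] → ℤ/n`, sending every group element to `1`. -/
noncomputable def levelAug (n : ℕ+) (U : OpenSubgroup Q) : Level Q n U →+* ZMod (n : ℕ) :=
  (MonoidAlgebra.lift (ZMod (n : ℕ)) (ZMod (n : ℕ)) (Q ⧸ (U : Subgroup Q)) 1).toRingHom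

theorem levelAug_transition {n n' : ℕ+} {U U' : OpenSubgroup Q} (hn : (n' : ℕ) ∣ n) (hU : U ≤ U')
    (r : Level Q n U) :
    levelAug n' U' (transition hn hU r) = ZMod.castHom hn (ZMod (n' : ℕ)) (levelAug n U r) := by
  have : (levelAug n' U').comp (transition hn hU) =
      (ZMod.castHom hn (ZMod (n' : ℕ))).comp (levelAug n U) := by
    refine MonoidAlgebra.ringHom_ext (fun c => ?_) (fun a => ?_) <;>
      simp [levelAug, transition]
  exact congrArg (fun f => f r) this

/-- The augmentation `ε : Ẑ⟦Q⟧ → Ẑ`, sending every element of `Q` to `1`. -/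
noncomputable def augmentation : CGA Q →+* ZHat where
  toFun r := ⟨fun n => levelAug n ⊤ (r.1 (n, ⊤)), fun n n' hn => 
    (levelAug_transition hn le_rfl _).symm.trans
      (congrArg (levelAug n' ⊤) (r.2 n n' ⊤ ⊤ hn le_rfl))⟩
  map_one' := by ext n; simp
  map_mul' r s := by ext n; simp
  map_zero' := by ext n; simp
  map_add' r s := by ext n; simp

/-- The canonical map `ℤ[Q] → (ℤ/n)[Q/U]`. -/
noncomputable def toLevel (n : ℕ+) (U : OpenSubgroup Q) : MonoidAlgebra ℤ Q →+* Level Q n U :=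
  (MonoidAlgebra.mapRingHom (Q ⧸ (U : Subgroup Q)) (Int.castRingHom (ZMod (n : ℕ)))).comp
    (MonoidAlgebra.mapDomainRingHom ℤ (QuotientGroup.mk' (U : Subgroup Q)))

theorem transition_toLevel {n n' : ℕ+} {U U' : OpenSubgroup Q} (hn : (n' : ℕ) ∣ n) (hU : U ≤ U')
    (s : MonoidAlgebra ℤ Q) : transition hn hU (toLevel n U s) = toLevel n' U' s := by
  have : (transition hn hU).comp (toLevel n U) = toLevel n' U' := by
    refine MonoidAlgebra.ringHom_ext (fun c => ?_) (fun a => ?_) <;>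
      simp [toLevel, transition, ZMod.cast_one hn]
    rfl
  exact congrArg (fun f => f s) this

/-- The canonical map `ℤ[Q] → Ẑ⟦Q⟧`. -/
noncomputable def toCGA : MonoidAlgebra ℤ Q →+* CGA Q where
  toFun s := ⟨fun p => toLevel p.1 p.2 s, fun _ _ _ _ hn hU => transition_toLevel hn hU s⟩
  map_one' := by ext p; simp
  map_mul' r s := by ext p; simp
  map_zero' := by ext p; simp
  map_add' r s := by ext p; simp

/-- The canonical map from `Q` to the units of `Ẑ⟦Q⟧`, viewed in `Ẑ⟦Q⟧`. -/
noncomputable def grp : Q →* CGA Q :=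
  (toCGA : MonoidAlgebra ℤ Q →+* CGA Q).toMonoidHom.comp (MonoidAlgebra.of ℤ Q)

theorem continuous_grp [IsTopologicalGroup Q] : Continuous (grp : Q → CGA Q) := by
  refine Continuous.subtype_mk (continuous_pi fun p => ?_) _
  have : DiscreteTopology (Q ⧸ (p.2 : Subgroup Q)) := QuotientGroup.discreteTopology p.2.isOpen'
  have h : (fun a : Q => toLevel p.1 p.2 (MonoidAlgebra.of ℤ Q a)) =
      (fun b : Q ⧸ (p.2 : Subgroup Q) =>
        (MonoidAlgebra.single b 1 : MonoidAlgebra (ZMod (p.1 : ℕ)) _)) ∘ QuotientGroup.mk := by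
    funext a
    simp [toLevel]
  change Continuous (fun a : Q => toLevel p.1 p.2 (MonoidAlgebra.of ℤ Q a))
  rw [h]
  exact continuous_of_discreteTopology.comp continuous_quotient_mk'

theorem finite_level [IsTopologicalGroup Q] [CompactSpace Q] (n : ℕ+) (U : OpenSubgroup Q) :
    Finite (Level Q n U) := by
  have : Finite (Q ⧸ (U : Subgroup Q)) := Subgroup.quotient_finite_of_isOpen _ U.isOpen'
  have : NeZero (n : ℕ) := ⟨n.pos.ne'⟩
  have : Finite (Q ⧸ (U : Subgroup Q) →₀ ZMod (n : ℕ)) :=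
    Finite.of_injective (fun f a => f a) DFunLike.coe_injective
  exact Finite.of_equiv _ (MonoidAlgebra.coeffEquiv (R := ZMod (n : ℕ)) (M := Q ⧸ (U : Subgroup Q))).symm

instance [IsTopologicalGroup Q] [CompactSpace Q] : CompactSpace (CGA Q) := by
  have := fun p : ℕ+ × OpenSubgroup Q => finite_level p.1 p.2
  have hc : IsClosed (CGA Q : Set (∀ p : ℕ+ × OpenSubgroup Q, Level Q p.1 p.2)) := by
    have : (CGA Q : Set (∀ p : ℕ+ × OpenSubgroup Q, Level Q p.1 p.2)) =
      ⋂ (n : ℕ+) (n' : ℕ+) (U : OpenSubgroup Q) (U' : OpenSubgroup Q) (hn : (n' : ℕ) ∣ n)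
        (hU : U ≤ U'), {r | transition hn hU (r (n, U)) = r (n', U')} := by
      ext r
      simp only [Set.mem_iInter]
      rfl
    rw [this]
    refine isClosed_iInter fun n => isClosed_iInter fun n' => isClosed_iInter fun U =>
      isClosed_iInter fun U' => isClosed_iInter fun hn => isClosed_iInter fun hU => ?_
    exact isClosed_eq (continuous_of_discreteTopology.comp (continuous_apply (n, U)))
      (continuous_apply (n', U'))
  exact isCompact_iff_compactSpace.mp hc.isCompact

end CompletedGroupAlgebra
/-- The ring `Λ = Ẑ⟦Â⟧`. -/
abbrev Lam : Type := CGA Ahat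

/-- The free `Λ`-module `T̂` with basis `t₁, t₂`, the standard basis. -/
abbrev That : Type := Fin 2 → Lam

/-- The action of `Â` on `T̂` through `Â → Λ`. -/
noncomputable def actT : Ahat →* MulAut (Multiplicative That) where
  toFun a :=
    { toFun := fun t => Multiplicative.ofAdd ((grp a : Lam) • t.toAdd)
      invFun := fun t => Multiplicative.ofAdd ((grp a⁻¹ : Lam) • t.toAdd)
      left_inv := fun t => by
        change Multiplicative.ofAdd ((grp a⁻¹ : Lam) • (grp a : Lam) • t.toAdd) = t
        rw [smul_smul, ← map_mul, inv_mul_cancel, map_one, one_smul, ofAdd_toAdd]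
      right_inv := fun t => by
        change Multiplicative.ofAdd ((grp a : Lam) • (grp a⁻¹ : Lam) • t.toAdd) = t
        rw [smul_smul, ← map_mul, mul_inv_cancel, map_one, one_smul, ofAdd_toAdd]
      map_mul' := fun t t' => by rw [toAdd_mul, smul_add, ofAdd_add] }
  map_one' := by
    ext1 t
    change Multiplicative.ofAdd ((grp (1 : Ahat) : Lam) • t.toAdd) = t
    rw [map_one, one_smul, ofAdd_toAdd]
  map_mul' a b := by
    ext1 t
    change Multiplicative.ofAdd ((grp (a * b) : Lam) • t.toAdd) =
      Multiplicative.ofAdd ((grp a : Lam) • (grp b : Lam) • t.toAdd)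
    rw [map_mul, smul_smul]

/-- The split extension `T̂ ⋊ Â`. -/
abbrev Split : Type := SemidirectProduct (Multiplicative That) Ahat actT

/-- `T̂ ⋊ Â` carries the product topology. -/
noncomputable instance : TopologicalSpace Split :=
  TopologicalSpace.induced SemidirectProduct.equivProd inferInstance

/-- The underlying space of `T̂ ⋊ Â` is `T̂ × Â`. -/
noncomputable def splitHomeo : Split ≃ₜ Multiplicative That × Ahat :=
  SemidirectProduct.equivProd.toHomeomorphOfIsInducing ⟨rfl⟩

theorem continuous_left : Continuous (fun p : Split => p.left.toAdd) :=
  continuous_toAdd.comp (continuous_fst.comp splitHomeo.continuous)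

theorem continuous_right : Continuous (fun p : Split => p.right) :=
  continuous_snd.comp splitHomeo.continuous

theorem continuous_split_mk {X : Type} [TopologicalSpace X] {f : X → That} {g : X → Ahat}
    (hf : Continuous f) (hg : Continuous g) :
    Continuous (fun z => (⟨Multiplicative.ofAdd (f z), g z⟩ : Split)) :=
  splitHomeo.symm.continuous.comp ((continuous_ofAdd.comp hf).prodMk hg)

instance : IsTopologicalGroup Split where
  continuous_mul := by
    have h1 : Continuous (fun p : Split × Split => p.1.left.toAdd + (grp p.1.right : Lam) • p.2.left.toAdd) :=
      (continuous_left.comp continuous_fst).add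
        ((continuous_grp.comp (continuous_right.comp continuous_fst)).smul
          (continuous_left.comp continuous_snd))
    have h2 : Continuous (fun p : Split × Split => p.1.right * p.2.right) :=
      (continuous_right.comp continuous_fst).mul (continuous_right.comp continuous_snd)
    exact continuous_split_mk h1 h2
  continuous_inv := by
    have h1 : Continuous (fun p : Split => (grp p.right⁻¹ : Lam) • (-p.left.toAdd)) :=
      (continuous_grp.comp continuous_right.inv).smul continuous_left.neg
    exact continuous_split_mk h1 continuous_right.inv

instance : CompactSpace Split :=
  haveI : CompactSpace (Multiplicative That) := inferInstanceAs (CompactSpace That)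
  splitHomeo.symm.compactSpace

instance : TotallyDisconnectedSpace Split :=
  haveI : TotallyDisconnectedSpace (Multiplicative That) :=
    inferInstanceAs (TotallyDisconnectedSpace That)
  splitHomeo.symm.totallyDisconnectedSpace

theorem split_law (a b c d : Split) : ⁅⁅a, b⁆, ⁅c, d⁆⁆ = 1 := by
  have h (a b : Split) : ⁅a, b⁆ = SemidirectProduct.inl (⁅a, b⁆ : Split).left := by
    ext1
    · rfl
    · change SemidirectProduct.rightHom ⁅a, b⁆ = 1
      rw [map_commutatorElement]
      exact commutatorElement_eq_one_iff_mul_comm.mpr (mul_comm _ _)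
  rw [h a b, h c d, ← map_commutatorElement,
    commutatorElement_eq_one_iff_mul_comm.mpr (mul_comm _ _), map_one]

/-- The closed derived subgroup `M̂'` is abelian. -/
instance : CommGroup Mder :=
  { (inferInstance : Group Mder) with
    mul_comm := fun u v => Subtype.ext (mder_comm u u.2 v v.2) }

/-- The conjugation action `a · m = ã m ã⁻¹` of `Â` on `M̂'`, for any lift `ã` of `a` to `M̂`,
as a representation on the additively written abelian group `M̂'`. -/
noncomputable def conjRep : Representation ℤ Ahat (Additive Mder) :=
  QuotientGroup.lift (commutator Mhat).topologicalClosure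
    { toFun := fun g =>
        (MonoidHom.toAdditive (MulAut.conjNormal g : MulAut Mder).toMonoidHom).toIntLinearMap
      map_one' := by ext m; simp
      map_mul' := fun g h => by ext m; simp [mul_assoc] }
    (fun g hg => by
      ext m
      change g * _ * g⁻¹ = _
      rw [mder_comm g hg _ (Subtype.property _), mul_inv_cancel_right]
      rfl)

theorem conjRep_mk (g : Mhat) (m : Mder) :
    (((conjRep (QuotientGroup.mk g : Ahat)) (Additive.ofMul m)).toMul : Mhat) = g * m * g⁻¹ :=
  rfl

/-- The action of `ℤ[Â]` on `M̂'` induced by conjugation, written multiplicatively. -/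
noncomputable def intPow (m : Mder) (s : MonoidAlgebra ℤ Ahat) : Mder :=
  (conjRep.asAlgebraHom s (Additive.ofMul m)).toMul

theorem toLevel_surjective {Q : Type} [CommGroup Q] [TopologicalSpace Q] (n : ℕ+)
    (U : OpenSubgroup Q) :
    Function.Surjective (toLevel n U : MonoidAlgebra ℤ Q → Level Q n U) := by
  intro r
  induction r using MonoidAlgebra.induction_linear with
  | zero => exact ⟨0, map_zero _⟩
  | add r s hr hs =>
    obtain ⟨a, rfl⟩ := hr
    obtain ⟨b, rfl⟩ := hs
    exact ⟨a + b, map_add _ _ _⟩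
  | single q c =>
    obtain ⟨a, rfl⟩ := QuotientGroup.mk_surjective q
    obtain ⟨k, rfl⟩ := ZMod.intCast_surjective c
    refine ⟨MonoidAlgebra.single a k, ?_⟩
    simp [toLevel]

theorem denseRange_toCGA {Q : Type} [CommGroup Q] [TopologicalSpace Q] :
    DenseRange (toCGA : MonoidAlgebra ℤ Q → CGA Q) := by
  intro r
  rw [mem_closure_iff]
  rintro W ⟨W', hW', rfl⟩ hr
  obtain ⟨J, u, hu, hJ⟩ := isOpen_pi_iff.mp hW' _ hr
  let n : ℕ+ := ∏ p ∈ J, p.1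
  let U : OpenSubgroup Q := J.inf Prod.snd
  obtain ⟨s, hs⟩ := toLevel_surjective n U (r.1 (n, U))
  refine ⟨toCGA s, hJ fun p hp => ?_, s, rfl⟩
  have hn : (p.1 : ℕ) ∣ n := PNat.dvd_iff.mp (Finset.dvd_prod_of_mem Prod.fst hp)
  have hU : U ≤ p.2 := Finset.inf_le hp
  have : (toCGA s).1 p = r.1 p := by
    rw [← r.2 n p.1 U p.2 hn hU, ← hs]
    exact (transition_toLevel hn hU s).symm
  rw [this]
  exact (hu p hp).2

/-- The action of `ℤ[Â]` on `M̂'` modulo an open normal subgroup of `M̂` factors through a finite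
level of `Λ`. -/
theorem exists_level (m : Mder) (N : OpenNormalSubgroup Mhat) :
    ∃ (n : ℕ+) (U : OpenSubgroup Ahat), ∀ s : MonoidAlgebra ℤ Ahat,
      toLevel n U s = 0 → (intPow m s : Mhat) ∈ N := by
  let mk : Mhat →* Ahat := QuotientGroup.mk' Mder
  have : Finite (Mhat ⧸ N.toSubgroup) := Subgroup.quotient_finite_of_isOpen _ N.isOpen'
  let n : ℕ+ := ⟨Nat.card (Mhat ⧸ N.toSubgroup), Nat.card_pos⟩
  let U : OpenSubgroup Ahat := ⟨N.toSubgroup.map mk, QuotientGroup.isOpenMap_coe _ N.isOpen'⟩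
  refine ⟨n, U, ?_⟩
  let W : AddSubgroup (Additive Mder) := Subgroup.toAddSubgroup (N.toSubgroup.subgroupOf Mder)
  let B := Additive Mder ⧸ W
  have hmk (v : Additive Mder) : (QuotientAddGroup.mk v : B) = 0 ↔ (v.toMul : Mhat) ∈ N :=
    QuotientAddGroup.eq_zero_iff v
  have hkill (b : B) : (n : ℕ) • b = 0 := by
    obtain ⟨v, rfl⟩ := QuotientAddGroup.mk_surjective b
    rw [← QuotientAddGroup.mk_nsmul, hmk]
    change ((v.toMul ^ (n : ℕ) : Mder) : Mhat) ∈ N.toSubgroup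
    rw [← QuotientGroup.eq_one_iff]
    exact pow_card_eq_one' (G := Mhat ⧸ N.toSubgroup) (x := QuotientGroup.mk (v.toMul : Mhat))
  have hconj (a a' : Ahat) (h : (QuotientGroup.mk a : Ahat ⧸ (U : Subgroup Ahat)) = QuotientGroup.mk a') :
      (QuotientAddGroup.mk (conjRep a (Additive.ofMul m)) : B) =
        QuotientAddGroup.mk (conjRep a' (Additive.ofMul m)) := by
    obtain ⟨g, rfl⟩ := QuotientGroup.mk_surjective a
    obtain ⟨g', rfl⟩ := QuotientGroup.mk_surjective a'
    obtain ⟨ν, hν, hνg⟩ := QuotientGroup.eq.mp h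
    have hc : (g * ν)⁻¹ * g' ∈ Mder := by
      refine QuotientGroup.eq.mp ?_
      have h1 : mk ν = (mk g)⁻¹ * mk g' := hνg
      change mk (g * ν) = mk g'
      rw [map_mul, h1, mul_inv_cancel_left]
    obtain ⟨c, hc', rfl⟩ : ∃ c ∈ Mder, g' = g * ν * c := ⟨_, hc, by group⟩
    rw [QuotientAddGroup.eq]
    change (g * m * g⁻¹)⁻¹ * (g * ν * c * m * (g * ν * c)⁻¹) ∈ N.toSubgroup
    have h2 : g * ν * c * m * (g * ν * c)⁻¹ = g * ν * m * ν⁻¹ * g⁻¹ := by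
      have h3 : c * m = m * c := mder_comm c hc' m m.2
      calc g * ν * c * m * (g * ν * c)⁻¹ = g * ν * (c * m) * c⁻¹ * ν⁻¹ * g⁻¹ := by group
        _ = g * ν * m * ν⁻¹ * g⁻¹ := by rw [h3]; group
    have h4 : (g * m * g⁻¹)⁻¹ * (g * ν * m * ν⁻¹ * g⁻¹) =
        g * (((m : Mhat)⁻¹ * ν * ((m : Mhat)⁻¹)⁻¹) * ν⁻¹) * g⁻¹ := by group
    have hN : N.toSubgroup.Normal := inferInstance
    rw [h2, h4]
    exact hN.conj_mem _ (N.toSubgroup.mul_mem (hN.conj_mem _ hν _) (N.toSubgroup.inv_mem hν)) _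
  let act : Ahat ⧸ (U : Subgroup Ahat) → B := Quotient.lift
    (fun a => (QuotientAddGroup.mk (conjRep a (Additive.ofMul m)) : B))
    (fun a a' h => hconj a a' (Quotient.sound h))
  let coef (q : Ahat ⧸ (U : Subgroup Ahat)) : ZMod (n : ℕ) →+ B :=
    ZMod.lift (n : ℕ) ⟨zmultiplesHom B (act q), by simpa using hkill (act q)⟩
  let ψ : Level Ahat n U →+ B :=
    (Finsupp.liftAddHom coef).comp (MonoidAlgebra.coeffAddEquiv).toAddMonoidHom
  have hψ (s : MonoidAlgebra ℤ Ahat) :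
      ψ (toLevel n U s) = QuotientAddGroup.mk (conjRep.asAlgebraHom s (Additive.ofMul m)) := by
    induction s using MonoidAlgebra.induction_linear with
    | zero => simp
    | add s t hs ht => rw [map_add, map_add, hs, ht, map_add]; rfl
    | single a k =>
      have : toLevel n U (MonoidAlgebra.single a k) =
          MonoidAlgebra.single (QuotientGroup.mk a : Ahat ⧸ (U : Subgroup Ahat))
            ((k : ZMod (n : ℕ))) := by simp [toLevel]
      rw [this]
      simp [ψ, coef]
      rfl
  intro s hs
  refine (hmk _).mp ?_
  rw [← hψ, hs, map_zero]

/-- The action of `Λ` on `M̂'`, written as exponentiation `m ^ r`: the extension by continuity of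
the action of `ℤ[Â]` by conjugation. -/
noncomputable def lamPow (m : Mder) (r : Lam) : Mder :=
  Filter.limUnder (Filter.comap (toCGA : MonoidAlgebra ℤ Ahat → Lam) (nhds r)) (intPow m)

theorem tendsto_lamPow (m : Mder) (r : Lam) :
    Filter.Tendsto (intPow m) (Filter.comap (toCGA : MonoidAlgebra ℤ Ahat → Lam) (nhds r))
      (nhds (lamPow m r)) := by
  have hne : (Filter.comap (toCGA : MonoidAlgebra ℤ Ahat → Lam) (nhds r)).NeBot :=
    Filter.comap_neBot fun t ht => by
      obtain ⟨_, h1, s, rfl⟩ := mem_closure_iff_nhds.mp (denseRange_toCGA r) t ht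
      exact ⟨s, h1⟩
  unfold lamPow
  refine tendsto_nhds_limUnder ?_
  obtain ⟨y, hy⟩ := exists_clusterPt_of_compactSpace
    (Filter.map (intPow m) (Filter.comap (toCGA : MonoidAlgebra ℤ Ahat → Lam) (nhds r)))
  refine ⟨y, fun V hV => ?_⟩
  obtain ⟨V', hV', hVV⟩ := (mem_nhds_induced _ _ _).mp hV
  have h1 : (fun g : Mhat => (y : Mhat) * g) ⁻¹' V' ∈ nhds (1 : Mhat) :=
    (continuous_const_mul (y : Mhat)).continuousAt.preimage_mem_nhds (by simpa using hV')
  obtain ⟨V₁, hV₁, hopen, hone⟩ := mem_nhds_iff.mp h1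
  obtain ⟨N, hN⟩ := ProfiniteGrp.exist_openNormalSubgroup_sub_open_nhds_of_one hopen hone
  obtain ⟨n, U, hnU⟩ := exists_level m N
  have hS : {s : MonoidAlgebra ℤ Ahat | toLevel n U s = r.1 (n, U)} ∈
      Filter.comap (toCGA : MonoidAlgebra ℤ Ahat → Lam) (nhds r) := by
    have hc : Continuous (fun r' : Lam => r'.1 (n, U)) :=
      (continuous_apply (n, U)).comp continuous_subtype_val
    exact ⟨_, hc.continuousAt.preimage_mem_nhds
      (IsOpen.mem_nhds (isOpen_discrete {r.1 (n, U)}) rfl), fun s hs => hs⟩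
  have hY : {v : Mder | (y : Mhat)⁻¹ * v ∈ N} ∈ nhds y := by
    have hc : Continuous (fun v : Mder => (y : Mhat)⁻¹ * v) := by fun_prop
    exact hc.continuousAt.preimage_mem_nhds
      (IsOpen.mem_nhds N.isOpen' (by simp))
  obtain ⟨_, ⟨hs₀, ⟨s₀, hs₀', rfl⟩⟩⟩ := clusterPt_iff_nonempty.mp hy hY (Filter.image_mem_map hS)
  refine Filter.mem_map.mpr (Filter.mem_of_superset hS fun s hs => hVV ?_)
  have h2 : toLevel n U (s - s₀) = 0 := by
    rw [map_sub, sub_eq_zero]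
    exact hs.trans hs₀'.symm
  have h3 : (intPow m s : Mhat) = intPow m s₀ * intPow m (s - s₀) := by
    have : intPow m s = intPow m s₀ * intPow m (s - s₀) := by
      apply Additive.ofMul.injective
      simp [intPow]
    rw [this]
    rfl
  have h4 : (y : Mhat)⁻¹ * intPow m s ∈ N.toSubgroup := by
    rw [h3, ← mul_assoc]
    exact N.toSubgroup.mul_mem hs₀ (hnU _ h2)
  have h5 := hV₁ (hN h4)
  simpa using h5

/-- The commutator `[x₁, x₂]`, as an element of `M̂'`. -/
def comm (x : Fin 2 → Mhat) : Mder :=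
  ⟨⁅x 0, x 1⁆, Subgroup.le_topologicalClosure _
    (Subgroup.commutator_mem_commutator (Subgroup.mem_top _) (Subgroup.mem_top _))⟩

/-- The image in `Â` of an element of `M̂`. -/
def ab : Mhat →* Ahat := QuotientGroup.mk' Mder

/-- An endomorphism of `M̂` is an IA-endomorphism if it induces the identity on `Â`. -/
def IsIA (γ : Mhat →ₜ* Mhat) : Prop := ∀ g, ab (γ g) = ab g

/-- The set `IAEnd(M̂)` of (continuous) IA-endomorphisms of `M̂`. -/
abbrev IAEnd : Type := {γ : Mhat →ₜ* Mhat // IsIA γ}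

/-- An endomorphism of `M̂` is an automorphism if it is bijective with continuous inverse. -/
def IsAutomorphism (γ : Mhat →ₜ* Mhat) : Prop := ∃ e : Mhat ≃ₜ* Mhat, ∀ g, e g = γ g

theorem exists_gamma {x : Fin 2 → Mhat} (hx : Generates x) (r : Fin 2 → Lam) :
    ∃ γ : IAEnd, ∀ i, γ.1 (x i) = lamPow (comm x) (r i) * x i := by
  obtain ⟨γ, hγ⟩ := exists_lift mhat_law hx (fun i => lamPow (comm x) (r i) * x i)
  let p : Mhat →ₜ* Ahat := ⟨ab, continuous_quotient_mk'⟩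
  have h : p.comp γ = p := eq_of_eq_on_gen hx fun i => by
    change ab (γ (x i)) = ab (x i)
    rw [hγ, map_mul]
    have : ab (lamPow (comm x) (r i)) = 1 := (QuotientGroup.eq_one_iff _).mpr (Subtype.property _)
    rw [this, one_mul]
  exact ⟨⟨γ, fun g => congrArg (fun k : Mhat →ₜ* Ahat => k g) h⟩, hγ⟩

/-- The IA-endomorphism `γ_r` of `M̂` with `γ_r(x_i) = [x₁, x₂]^{r_i} x_i` for `i = 1, 2`; it is
unique since `x₁, x₂` generate `M̂`. -/
noncomputable def gamma {x : Fin 2 → Mhat} (hx : Generates x) (r : Fin 2 → Lam) : IAEnd :=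
  (exists_gamma hx r).choose

theorem gamma_apply {x : Fin 2 → Mhat} (hx : Generates x) (r : Fin 2 → Lam) (i : Fin 2) :
    (gamma hx r).1 (x i) = lamPow (comm x) (r i) * x i :=
  (exists_gamma hx r).choose_spec i

theorem exists_magnus {x : Fin 2 → Mhat} (hx : Generates x) :
    ∃ μ : Mhat →ₜ* Split, ∀ i, μ (x i) = ⟨Multiplicative.ofAdd (Pi.single i 1), ab (x i)⟩ :=
  exists_lift split_law hx _

/-- The Magnus homomorphism `μ : M̂ → T̂ ⋊ Â` with `μ(x_i) = (t_i, a_i)`; it is unique since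
`x₁, x₂` generate `M̂`. -/
noncomputable def magnus {x : Fin 2 → Mhat} (hx : Generates x) : Mhat →ₜ* Split :=
  (exists_magnus hx).choose

theorem magnus_apply {x : Fin 2 → Mhat} (hx : Generates x) (i : Fin 2) :
    magnus hx (x i) = ⟨Multiplicative.ofAdd (Pi.single i 1), ab (x i)⟩ :=
  (exists_magnus hx).choose_spec i

/-- The Bachmuth representation `β(γ) ∈ End_Λ(T̂)` of an IA-endomorphism `γ` of `M̂`, determined by
`μ(γ(x_i)) = (β(γ)(t_i), a_i)`. -/
noncomputable def bachmuth {x : Fin 2 → Mhat} (hx : Generates x) (γ : IAEnd) : That →ₗ[Lam] That :=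
  (Pi.basisFun Lam (Fin 2)).constr Lam (fun i => (magnus hx (γ.1 (x i))).left.toAdd)

/-- The Bachmuth determinant of an IA-endomorphism of `M̂`. -/
noncomputable def bachmuthDet {x : Fin 2 → Mhat} (hx : Generates x) (γ : IAEnd) : Lam :=
  LinearMap.det (bachmuth hx γ)

/-- The special elements of `Λ`: those of augmentation `1`. -/
def specialElements : Set Lam := {b | augmentation b = 1}

/-- The special units of `Λ`: the units of augmentation `1`. -/
def specialUnits : Set Lam := {b | IsUnit b ∧ augmentation b = 1}

end ProMetabelian

open ProMetabelian

/-!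
Write `c = [x₁, x₂]`. By density of `ℤ[Â]` in `Λ`, exponentiation makes `M̂'` a `Λ`-module, and
every continuous homomorphism on `M̂'` that is compatible with conjugation is `Λ`-linear
(`map_lam_smul`).

*Determinant.* The Magnus homomorphism restricts to a `Λ`-linear map `M̂' → T̂` sending `c` to
`v = (1 - a₂) t₁ + (a₁ - 1) t₂`. Hence `β(γ_r)` sends `t_i` to `t_i + r_i v`; this rank-one
perturbation of the identity has determinant `1 + r₁(1 - a₂) + r₂(a₁ - 1)`
(`bachmuthDet_gamma`).

*Automorphisms.* Since `β` is multiplicative, the determinant of an automorphism is a unit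
(`isUnit_bachmuthDet`). Conversely, expanding `[c ^ r₁ x₁, c ^ r₂ x₂]` inside `M̂` gives
`γ_r(c) = c ^ d` with `d = det γ_r` (`der_gamma_comm`), so `γ_r ∘ γ_s` sends `x_i` to
`c ^ (s_i d + r_i) x_i`. If `d` is a unit, `s = -d⁻¹ r` makes this exponent vanish, and then
`det γ_s = d⁻¹`, so that by symmetry `γ_s ∘ γ_r` is the identity as well. In particular the
injectivity of the Magnus homomorphism is not needed.

*Image.* The claim amounts to the augmentation ideal of `Λ` being generated by `1 - a₂` and
`a₁ - 1`. The ideal these generate is compact, hence closed. It contains `a - 1` for every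
`a ∈ Â`, because `a₁, a₂` generate `Â` topologically, and so it contains `s - ε(s)` for
`s ∈ ℤ[Â]`. Elements of this form are dense in the augmentation ideal
(`mem_of_augmentation_eq_zero`).
-/

namespace ProMetabelian

/-! ### The action of `Λ` on the derived subgroup -/

theorem lamPow_toCGA (m : Mder) (s : MonoidAlgebra ℤ Ahat) :
    lamPow m (toCGA s) = intPow m s := by
  refine tendsto_nhds_unique (f := intPow m) (l := pure s) ?_ (tendsto_pure_nhds _ _)
  refine (tendsto_lamPow m (toCGA s)).mono_left ?_
  exact Filter.map_le_iff_le_comap.mp ((Filter.map_pure _ _).trans_le (pure_le_nhds _))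

theorem continuous_lamPow (m : Mder) : Continuous (lamPow m) := by
  let _ : TopologicalSpace (MonoidAlgebra ℤ Ahat) :=
    TopologicalSpace.induced (toCGA : MonoidAlgebra ℤ Ahat → Lam) inferInstance
  have di : IsDenseInducing (toCGA : MonoidAlgebra ℤ Ahat → Lam) := ⟨⟨rfl⟩, denseRange_toCGA⟩
  exact di.continuous_extend fun r => ⟨_, tendsto_lamPow m r⟩

/-- Two continuous functions on `Λ` agree once they agree on `ℤ[Â]`. -/
theorem lam_funext {X : Type*} [TopologicalSpace X] [T2Space X] {f g : Lam → X}
    (hf : Continuous f) (hg : Continuous g)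
    (h : ∀ s : MonoidAlgebra ℤ Ahat, f (toCGA s) = g (toCGA s)) (r : Lam) : f r = g r :=
  congrFun (denseRange_toCGA.equalizer hf hg (funext h)) r

theorem continuous_conjRep (a : Ahat) : Continuous (conjRep a) := by
  obtain ⟨g, rfl⟩ := QuotientGroup.mk_surjective a
  have h : Continuous fun m : Mder => g * (m : Mhat) * g⁻¹ := by fun_prop
  exact continuous_ofMul.comp ((h.subtype_mk fun m =>
    (conjRep (QuotientGroup.mk g) (Additive.ofMul m)).toMul.2).comp continuous_toMul)

theorem continuous_intPow (s : MonoidAlgebra ℤ Ahat) : Continuous (fun m => intPow m s) := by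
  have h : Continuous (conjRep.asAlgebraHom s) := by
    induction s using MonoidAlgebra.induction_linear with
    | zero =>
      rw [map_zero]
      exact continuous_zero
    | add s t hs ht =>
      rw [map_add]
      exact hs.add ht
    | single a k =>
      rw [Representation.asAlgebraHom_single]
      exact (continuous_conjRep a).const_smul k
  exact continuous_toMul.comp (h.comp continuous_ofMul)

theorem intPow_add (m : Mder) (s t : MonoidAlgebra ℤ Ahat) :
    intPow m (s + t) = intPow m s * intPow m t := by
  apply Additive.ofMul.injective
  simp [intPow]

theorem intPow_mul (m : Mder) (s t : MonoidAlgebra ℤ Ahat) :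
    intPow m (s * t) = intPow (intPow m t) s := by
  simp [intPow]

theorem mul_intPow (m m' : Mder) (s : MonoidAlgebra ℤ Ahat) :
    intPow (m * m') s = intPow m s * intPow m' s := by
  simp [intPow]

theorem lamPow_add (m : Mder) (r s : Lam) : lamPow m (r + s) = lamPow m r * lamPow m s := by
  have hc := continuous_lamPow m
  refine lam_funext (f := fun r => lamPow m (r + s)) (g := fun r => lamPow m r * lamPow m s)
    (by fun_prop) (by fun_prop) (fun r => ?_) r
  refine lam_funext (f := fun s => lamPow m (toCGA r + s))
    (g := fun s => lamPow m (toCGA r) * lamPow m s) (by fun_prop) (by fun_prop) (fun s => ?_) s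
  rw [← map_add]
  simp only [lamPow_toCGA, intPow_add]

theorem mul_lamPow (m m' : Mder) (r : Lam) : lamPow (m * m') r = lamPow m r * lamPow m' r := by
  refine lam_funext (g := fun r => lamPow m r * lamPow m' r) (continuous_lamPow _)
    ((continuous_lamPow m).mul (continuous_lamPow m')) (fun r => ?_) r
  simp only [lamPow_toCGA, mul_intPow]

theorem lamPow_mul (m : Mder) (r s : Lam) : lamPow m (r * s) = lamPow (lamPow m s) r := by
  have hc := continuous_lamPow m
  refine lam_funext (f := fun r => lamPow m (r * s)) (g := lamPow (lamPow m s))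
    (hc.comp (continuous_mul_const s)) (continuous_lamPow _) (fun r => ?_) r
  rw [lamPow_toCGA]
  refine lam_funext (f := fun s => lamPow m (toCGA r * s)) (g := fun s => intPow (lamPow m s) r)
    (hc.comp (continuous_const_mul _)) ((continuous_intPow r).comp hc) (fun s => ?_) s
  rw [← map_mul, lamPow_toCGA, lamPow_toCGA, intPow_mul]

theorem lamPow_one (m : Mder) : lamPow m 1 = m := by
  rw [← map_one toCGA, lamPow_toCGA]
  simp [intPow]

/-- The exponentiation `m ^ r` makes `M̂'`, written additively, a `Λ`-module. -/
noncomputable instance : Module Lam (Additive Mder) where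
  smul r m := Additive.ofMul (lamPow m.toMul r)
  one_smul m := congrArg Additive.ofMul (lamPow_one _)
  mul_smul r s m := congrArg Additive.ofMul (lamPow_mul _ r s)
  add_smul r s m := congrArg Additive.ofMul (lamPow_add _ r s)
  smul_add r m m' := congrArg Additive.ofMul (mul_lamPow m.toMul m'.toMul r)
  smul_zero r := by
    have h := mul_lamPow 1 1 r
    rw [one_mul] at h
    exact congrArg Additive.ofMul (left_eq_mul.mp h)
  zero_smul m := by
    have h := lamPow_add m.toMul 0 0
    rw [add_zero] at h
    exact congrArg Additive.ofMul (left_eq_mul.mp h)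

theorem toCGA_smul (s : MonoidAlgebra ℤ Ahat) (m : Additive Mder) :
    (toCGA s : Lam) • m = conjRep.asAlgebraHom s m :=
  congrArg Additive.ofMul (lamPow_toCGA m.toMul s)

theorem grp_smul (a : Ahat) (m : Additive Mder) : (grp a : Lam) • m = conjRep a m := by
  refine (toCGA_smul _ m).trans ?_
  simp

theorem continuous_smul_left (m : Additive Mder) : Continuous fun r : Lam => r • m :=
  continuous_ofMul.comp (continuous_lamPow m.toMul)

/-- A continuous additive map on `M̂'` that commutes with the action of `Â` is `Λ`-linear. -/
theorem map_lam_smul {X : Type*} [AddCommGroup X] [TopologicalSpace X] [T2Space X] [Module Lam X]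
    (hX : ∀ v : X, Continuous fun r : Lam => r • v) (f : Additive Mder →+ X) (hf : Continuous f)
    (h : ∀ (a : Ahat) m, f ((grp a : Lam) • m) = (grp a : Lam) • f m) (r : Lam)
    (m : Additive Mder) : f (r • m) = r • f m := by
  refine lam_funext (f := fun r => f (r • m)) (hf.comp (continuous_smul_left m)) (hX _)
    (fun s => ?_) r
  induction s using MonoidAlgebra.induction_linear with
  | zero => simp
  | add s t hs ht => simp only [map_add, add_smul, hs, ht]
  | single a k =>
    have hk : (toCGA (MonoidAlgebra.single a k) : Lam) = k • grp a := by
      rw [grp, MonoidHom.comp_apply, RingHom.toMonoidHom_eq_coe, MonoidHom.coe_coe, ← map_zsmul]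
      simp
    rw [hk, smul_assoc, smul_assoc, map_zsmul, h]

/-! ### Endomorphisms restricted to the derived subgroup -/

theorem ab_eq_one_iff (g : Mhat) : ab g = 1 ↔ g ∈ Mder := QuotientGroup.eq_one_iff g

theorem continuous_ab : Continuous ab := continuous_quotient_mk'

theorem coe_grp_smul (g : Mhat) (m : Additive Mder) :
    (((grp (ab g) : Lam) • m).toMul : Mhat) = g * (m.toMul : Mhat) * g⁻¹ := by
  rw [grp_smul]
  exact conjRep_mk g m.toMul

/-- The restriction of an IA-endomorphism of `M̂` to `M̂'`. -/
def IAEnd.der (γ : IAEnd) : Additive Mder →+ Additive Mder :=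
  MonoidHom.toAdditive (((γ.1 : Mhat →* Mhat).comp Mder.subtype).codRestrict Mder fun m => by
    rw [← ab_eq_one_iff]
    exact (γ.2 m).trans ((ab_eq_one_iff _).mpr m.2))

theorem IAEnd.coe_der (γ : IAEnd) (m : Additive Mder) :
    ((γ.der m).toMul : Mhat) = γ.1 (m.toMul : Mhat) := rfl

theorem IAEnd.der_smul (γ : IAEnd) (r : Lam) (m : Additive Mder) :
    γ.der (r • m) = r • γ.der m := by
  refine map_lam_smul continuous_smul_left γ.der ?_ (fun a m => ?_) r m
  · exact continuous_ofMul.comp ((Continuous.subtype_mk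
      ((map_continuous γ.1).comp continuous_subtype_val) _).comp continuous_toMul)
  · obtain ⟨g, rfl⟩ : ∃ g, ab g = a := QuotientGroup.mk_surjective a
    apply Additive.toMul.injective
    apply Subtype.ext
    rw [γ.coe_der, coe_grp_smul, map_mul, map_mul, map_inv, ← γ.2 g, coe_grp_smul, γ.coe_der]

section Basis

variable {x : Fin 2 → Mhat} (hx : Generates x)

/-- `γ_r` raises the commutator `[x₁, x₂]` to the power `1 + r₁(1 - a₂) + r₂(a₁ - 1)`. -/
theorem der_gamma_comm (r : Fin 2 → Lam) :
    (gamma hx r).der (Additive.ofMul (comm x)) =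
      (1 + r 0 * (1 - grp (ab (x 1))) + r 1 * (grp (ab (x 0)) - 1)) •
        Additive.ofMul (comm x) := by
  set c := Additive.ofMul (comm x) with hc
  have h : (1 + r 0 * (1 - grp (ab (x 1))) + r 1 * (grp (ab (x 0)) - 1)) • c =
      r 0 • c + grp (ab (x 0)) • r 1 • c + c - grp (ab (x 1)) • r 0 • c - r 1 • c := by
    module
  rw [h]
  apply Additive.toMul.injective
  apply Subtype.ext
  have h0 : (gamma hx r).1 (x 0) = ((r 0 • c).toMul : Mhat) * x 0 := gamma_apply hx r 0
  have h1 : (gamma hx r).1 (x 1) = ((r 1 • c).toMul : Mhat) * x 1 := gamma_apply hx r 1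
  have hL : (((gamma hx r).der c).toMul : Mhat) =
      ⁅((r 0 • c).toMul : Mhat) * x 0, ((r 1 • c).toMul : Mhat) * x 1⁆ := by
    rw [← h0, ← h1, ← map_commutatorElement]
    rfl
  rw [hL]
  simp only [toMul_sub, toMul_add, Subgroup.coe_mul, Subgroup.coe_div, coe_grp_smul]
  have hcc : (c.toMul : Mhat) = ⁅x 0, x 1⁆ := rfl
  generalize r 0 • c = u
  generalize r 1 • c = v
  rw [hcc]
  simp only [commutatorElement_def, div_eq_mul_inv]
  group

/-! ### The Magnus homomorphism on the derived subgroup -/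

theorem magnus_right (g : Mhat) : (magnus hx g).right = ab g := by
  have h : (⟨SemidirectProduct.rightHom, continuous_right⟩ : Split →ₜ* Ahat).comp (magnus hx) =
      ⟨ab, continuous_ab⟩ := eq_of_eq_on_gen hx fun i => by
    change (magnus hx (x i)).right = ab (x i)
    rw [magnus_apply]
  exact congrArg (fun k : Mhat →ₜ* Ahat => k g) h

/-- The `T̂`-component of the Magnus homomorphism is a crossed homomorphism. -/
theorem magnus_mul_left (g h : Mhat) : (magnus hx (g * h)).left.toAdd =
    (magnus hx g).left.toAdd + (grp (ab g) : Lam) • (magnus hx h).left.toAdd := by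
  rw [map_mul, ← magnus_right hx g]
  rfl

theorem magnus_gen_left (i : Fin 2) : (magnus hx (x i)).left.toAdd = Pi.single i 1 := by
  rw [magnus_apply]
  rfl

theorem ab_coe (m : Additive Mder) : ab (m.toMul : Mhat) = 1 := (ab_eq_one_iff _).mpr m.toMul.2

/-- The Magnus homomorphism restricts to an additive map `M̂' → T̂`. -/
noncomputable def magnusDer : Additive Mder →+ That where
  toFun m := (magnus hx (m.toMul : Mhat)).left.toAdd
  map_zero' := by
    change (magnus hx (1 : Mhat)).left.toAdd = 0
    rw [map_one]
    rfl
  map_add' m m' := by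
    change (magnus hx ((m.toMul : Mhat) * m'.toMul)).left.toAdd = _
    rw [magnus_mul_left, ab_coe, map_one, one_smul]

theorem magnusDer_smul (r : Lam) (m : Additive Mder) :
    magnusDer hx (r • m) = r • magnusDer hx m := by
  refine map_lam_smul
    (fun v => continuous_pi fun i => continuous_mul_const (v i)) (magnusDer hx) ?_
    (fun a m => ?_) r m
  · exact continuous_left.comp ((map_continuous (magnus hx)).comp
      (continuous_subtype_val.comp continuous_toMul))
  · obtain ⟨g, rfl⟩ : ∃ g, ab g = a := QuotientGroup.mk_surjective a
    have h := magnus_mul_left hx g (m.toMul : Mhat)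
    have h' := magnus_mul_left hx (g * (m.toMul : Mhat) * g⁻¹) g
    have hconj : ab (g * (m.toMul : Mhat) * g⁻¹) = 1 := by
      rw [map_mul, map_mul, map_inv, ab_coe, mul_one, mul_inv_cancel]
    rw [inv_mul_cancel_right, h, hconj, map_one, one_smul, add_comm, add_left_inj] at h'
    change (magnus hx ((grp (ab g) : Lam) • m).toMul).left.toAdd = _
    rw [coe_grp_smul, ← h']
    rfl

/-- `μ([x₁, x₂]) = (1 - a₂) t₁ + (a₁ - 1) t₂`. -/
theorem magnusDer_comm : magnusDer hx (Additive.ofMul (comm x)) =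
    ![1 - grp (ab (x 1)), grp (ab (x 0)) - 1] := by
  have h := magnus_mul_left hx ⁅x 0, x 1⁆ (x 1 * x 0)
  have h1 : ⁅x 0, x 1⁆ * (x 1 * x 0) = x 0 * x 1 := by
    rw [commutatorElement_def]
    group
  have h2 : ab ⁅x 0, x 1⁆ = 1 := ab_coe (Additive.ofMul (comm x))
  rw [h1, h2, map_one, one_smul, magnus_mul_left, magnus_mul_left, magnus_gen_left,
    magnus_gen_left] at h
  change (magnus hx ⁅x 0, x 1⁆).left.toAdd = _
  rw [← sub_eq_iff_eq_add.mpr h]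
  ext1 i
  fin_cases i <;> simp

/-! ### The Bachmuth representation -/

theorem bachmuth_single (γ : IAEnd) (i : Fin 2) :
    bachmuth hx γ (Pi.single i 1) = (magnus hx (γ.1 (x i))).left.toAdd := by
  have h := (Pi.basisFun Lam (Fin 2)).constr_basis Lam
    (fun i => (magnus hx (γ.1 (x i))).left.toAdd) i
  rwa [Pi.basisFun_apply] at h

/-- The matrix of `β(γ_r)` is a rank-one perturbation of the identity. -/
theorem bachmuth_gamma_single (r : Fin 2 → Lam) (i : Fin 2) :
    bachmuth hx (gamma hx r) (Pi.single i 1) =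
      r i • ![1 - grp (ab (x 1)), grp (ab (x 0)) - 1] + Pi.single i 1 := by
  have h : ab (lamPow (comm x) (r i) : Mhat) = 1 := ab_coe (Additive.ofMul _)
  rw [bachmuth_single, gamma_apply, magnus_mul_left, h, map_one, one_smul, magnus_gen_left,
    ← magnusDer_comm hx, ← magnusDer_smul]
  rfl

theorem bachmuthDet_gamma (r : Fin 2 → Lam) : bachmuthDet hx (gamma hx r) =
    1 + r 0 * (1 - grp (ab (x 1))) + r 1 * (grp (ab (x 0)) - 1) := by
  rw [bachmuthDet, ← LinearMap.det_toMatrix (Pi.basisFun Lam (Fin 2)), Matrix.det_fin_two]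
  simp only [LinearMap.toMatrix_apply, Pi.basisFun_apply, bachmuth_gamma_single,
    Pi.basisFun_repr]
  simp
  ring

/-- `β(γ)` describes `γ` through the Magnus homomorphism on all of `M̂`, not only on `x₁, x₂`. -/
theorem magnus_apply_left (γ : IAEnd) (g : Mhat) :
    (magnus hx (γ.1 g)).left.toAdd = bachmuth hx γ (magnus hx g).left.toAdd := by
  let B : Split →ₜ* Split :=
    { toFun := fun p => ⟨Multiplicative.ofAdd (bachmuth hx γ p.left.toAdd), p.right⟩
      map_one' := by
        change (⟨Multiplicative.ofAdd (bachmuth hx γ 0), 1⟩ : Split) = 1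
        rw [map_zero]
        rfl
      map_mul' := fun p q => by
        ext1
        · change Multiplicative.ofAdd (bachmuth hx γ (p.left.toAdd +
            (grp p.right : Lam) • q.left.toAdd)) = _
          rw [map_add, map_smul]
          rfl
        · rfl
      continuous_toFun := continuous_split_mk
        ((LinearMap.continuous_on_pi (bachmuth hx γ)).comp continuous_left) continuous_right }
  have h : (magnus hx).comp γ.1 = B.comp (magnus hx) := eq_of_eq_on_gen hx fun i => by
    change magnus hx (γ.1 (x i)) =
      ⟨Multiplicative.ofAdd (bachmuth hx γ (magnus hx (x i)).left.toAdd), (magnus hx (x i)).right⟩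
    rw [magnus_gen_left, bachmuth_single, magnus_right, ← γ.2 (x i), ← magnus_right hx]
    rfl
  exact congrArg (fun k : Mhat →ₜ* Split => (k g).left.toAdd) h

theorem bachmuth_comp_eq_one {γ δ : IAEnd} (h : ∀ g, γ.1 (δ.1 g) = g) :
    bachmuth hx γ * bachmuth hx δ = 1 := by
  refine (Pi.basisFun Lam (Fin 2)).ext fun i => ?_
  rw [Pi.basisFun_apply, Module.End.mul_apply, bachmuth_single, ← magnus_apply_left, h,
    magnus_gen_left]
  rfl

theorem isUnit_bachmuthDet {γ : IAEnd} (hγ : IsAutomorphism γ.1) :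
    IsUnit (bachmuthDet hx γ) := by
  obtain ⟨e, he⟩ := hγ
  let δ : IAEnd := ⟨e.symm, fun g => by
    have h := γ.2 (e.symm g)
    rw [← he, ContinuousMulEquiv.apply_symm_apply] at h
    exact h.symm⟩
  have h : bachmuth hx γ * bachmuth hx δ = 1 := bachmuth_comp_eq_one hx fun g => by
    rw [← he]
    exact e.apply_symm_apply g
  refine .of_mul_eq_one (bachmuthDet hx δ) ?_
  rw [bachmuthDet, bachmuthDet, ← LinearMap.det_comp]
  exact (congrArg _ h).trans (map_one _)

/-! ### Inverting `γ_r` -/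

theorem gamma_gamma_gen (r s : Fin 2 → Lam) (i : Fin 2) :
    (gamma hx r).1 ((gamma hx s).1 (x i)) =
      (((s i * bachmuthDet hx (gamma hx r) + r i) • Additive.ofMul (comm x)).toMul : Mhat) *
        x i := by
  have h : (gamma hx s).1 (x i) = ((s i • Additive.ofMul (comm x)).toMul : Mhat) * x i :=
    gamma_apply hx s i
  rw [h, map_mul, ← IAEnd.coe_der, IAEnd.der_smul, der_gamma_comm, ← bachmuthDet_gamma,
    gamma_apply, ← mul_assoc, add_smul, mul_smul]
  rfl

theorem gamma_gamma_eq_self {r s : Fin 2 → Lam}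
    (h : ∀ i, s i * bachmuthDet hx (gamma hx r) + r i = 0) (g : Mhat) :
    (gamma hx r).1 ((gamma hx s).1 g) = g := by
  have h' : (gamma hx r).1.comp (gamma hx s).1 = ContinuousMonoidHom.id Mhat :=
    eq_of_eq_on_gen hx fun i => by
      refine (gamma_gamma_gen hx r s i).trans ?_
      rw [h, zero_smul]
      exact one_mul _
  exact congrArg (fun k : Mhat →ₜ* Mhat => k g) h'

/-- If `d = det γ_r` is a unit, then `γ_s` with `s = -d⁻¹ r` is inverse to `γ_r`. -/
theorem isAutomorphism_gamma {r : Fin 2 → Lam} (hr : IsUnit (bachmuthDet hx (gamma hx r))) :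
    IsAutomorphism (gamma hx r).1 := by
  obtain ⟨d, hd⟩ := hr
  let s : Fin 2 → Lam := fun i => -(r i * ↑d⁻¹)
  have hdr := bachmuthDet_gamma hx r
  have hds : bachmuthDet hx (gamma hx s) = ↑d⁻¹ := by
    have h : (↑d⁻¹ : Lam) * d = 1 := d.inv_mul
    rw [← hd] at hdr
    rw [bachmuthDet_gamma]
    linear_combination (↑d⁻¹ : Lam) * hdr - h
  have h1 := gamma_gamma_eq_self hx (r := r) (s := s) fun i => by
    rw [← hd, neg_mul, Units.inv_mul_cancel_right, neg_add_cancel]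
  have h2 := gamma_gamma_eq_self hx (r := s) (s := r) fun i => by
    rw [hds]
    exact add_neg_cancel _
  exact ⟨{ toFun := (gamma hx r).1
           invFun := (gamma hx s).1
           left_inv := h2
           right_inv := h1
           map_mul' := map_mul _
           continuous_toFun := map_continuous _
           continuous_invFun := map_continuous _ }, fun _ => rfl⟩

end Basis

/-! ### The augmentation ideal -/

section Augmentation

variable {Q : Type} [CommGroup Q] [TopologicalSpace Q]

theorem augmentation_grp (a : Q) : augmentation (grp a : CGA Q) = 1 := by
  ext n
  change levelAug n ⊤ (toLevel n ⊤ (MonoidAlgebra.of ℤ Q a)) = 1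
  simp [levelAug, toLevel]

/-- The augmentation can be read off at any level. -/
theorem levelAug_eq_augmentation (r : CGA Q) (n : ℕ+) (U : OpenSubgroup Q) :
    levelAug n U (r.1 (n, U)) = (augmentation r).1 n := by
  have h := levelAug_transition (dvd_refl (n : ℕ)) (le_top : U ≤ ⊤) (r.1 (n, U))
  rw [r.2 n n U ⊤ dvd_rfl le_top, ZMod.castHom_self, RingHom.id_apply] at h
  exact h.symm

theorem toCGA_single_one (k : ℤ) :
    (toCGA (MonoidAlgebra.single (1 : Q) k) : CGA Q) = (k : CGA Q) := by
  rw [← map_intCast (toCGA : MonoidAlgebra ℤ Q →+* CGA Q)]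
  rfl

theorem toCGA_single (a : Q) (k : ℤ) :
    (toCGA (MonoidAlgebra.single a k) : CGA Q) = k * grp a := by
  rw [← toCGA_single_one, grp]
  change _ = toCGA _ * toCGA (MonoidAlgebra.of ℤ Q a)
  rw [← map_mul]
  simp

/-- Every neighbourhood of `r` contains all elements that agree with `r` at some finite level. -/
theorem exists_level_mem {r : CGA Q} {W : Set (CGA Q)} (hW : W ∈ nhds r) :
    ∃ (n : ℕ+) (U : OpenSubgroup Q), ∀ t : CGA Q, t.1 (n, U) = r.1 (n, U) → t ∈ W := by
  obtain ⟨W', hW', hWW⟩ := (mem_nhds_induced _ _ _).mp hW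
  obtain ⟨V, hVW, hV, hrV⟩ := mem_nhds_iff.mp hW'
  obtain ⟨J, u, hu, hJ⟩ := isOpen_pi_iff.mp hV _ hrV
  refine ⟨∏ p ∈ J, p.1, J.inf Prod.snd, fun t ht => hWW (hVW (hJ fun p hp => ?_))⟩
  have hn : (p.1 : ℕ) ∣ (∏ p ∈ J, p.1 : ℕ+) :=
    PNat.dvd_iff.mp (Finset.dvd_prod_of_mem Prod.fst hp)
  have hU : J.inf Prod.snd ≤ p.2 := Finset.inf_le hp
  have h : t.1 p = r.1 p := by
    rw [← t.2 _ p.1 _ p.2 hn hU, ← r.2 _ p.1 _ p.2 hn hU, ht]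
  rw [h]
  exact (hu p hp).2

/-- A closed ideal of `Ẑ⟦Q⟧` containing `a - 1` for all `a ∈ Q` contains the augmentation
ideal. -/
theorem mem_of_augmentation_eq_zero {J : Ideal (CGA Q)} (hJ : IsClosed (J : Set (CGA Q)))
    (h : ∀ a : Q, grp a - 1 ∈ J) {r : CGA Q} (hr : augmentation r = 0) : r ∈ J := by
  -- every element of `ℤ[Q]` is congruent modulo `J` to its augmentation
  have key (s : MonoidAlgebra ℤ Q) :
      ∃ k : ℤ, augmentation (toCGA s) = (k : ZHat) ∧ toCGA s - (k : CGA Q) ∈ J := by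
    induction s using MonoidAlgebra.induction_linear with
    | zero => exact ⟨0, by simp, by simp⟩
    | add s t hs ht =>
      obtain ⟨k, hk, hkJ⟩ := hs
      obtain ⟨l, hl, hlJ⟩ := ht
      refine ⟨k + l, by rw [map_add, map_add, hk, hl, Int.cast_add], ?_⟩
      have := J.add_mem hkJ hlJ
      rwa [sub_add_sub_comm, ← map_add, ← Int.cast_add] at this
    | single a k =>
      refine ⟨k, by rw [toCGA_single, map_mul, map_intCast, augmentation_grp, mul_one], ?_⟩
      have := J.mul_mem_left (k : CGA Q) (h a)
      rwa [mul_sub, mul_one, ← toCGA_single] at this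
  refine hJ.closure_subset (mem_closure_iff_nhds.mpr fun W hW => ?_)
  obtain ⟨n, U, hnU⟩ := exists_level_mem hW
  obtain ⟨s, hs⟩ := toLevel_surjective n U (r.1 (n, U))
  obtain ⟨k, hk, hkJ⟩ := key s
  refine ⟨_, hnU _ ?_, hkJ⟩
  -- the augmentations of `s` and `r` agree modulo `n`, so `k` vanishes at the level `(n, U)`
  have hk0 : (k : ZMod (n : ℕ)) = 0 := by
    have h1 := levelAug_eq_augmentation r n U
    have h2 := levelAug_eq_augmentation (toCGA s) n U
    have h3 : (toCGA s).1 (n, U) = r.1 (n, U) := hs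
    rw [h3, h1, hr, hk] at h2
    exact h2.symm
  have hk1 : (k : Level Q n U) = 0 := by
    rw [← map_intCast (algebraMap (ZMod (n : ℕ)) (Level Q n U)), hk0, map_zero]
  change toLevel n U s - (k : Level Q n U) = r.1 (n, U)
  rw [hk1, sub_zero, hs]

end Augmentation

section Basis

variable {x : Fin 2 → Mhat} (hx : Generates x)

theorem isClosed_span_pair {R : Type*} [CommRing R] [TopologicalSpace R] [IsTopologicalRing R]
    [CompactSpace R] [T2Space R] (a b : R) : IsClosed (Ideal.span {a, b} : Set R) := by
  have h : (Ideal.span {a, b} : Set R) = Set.range fun p : R × R => p.1 * a + p.2 * b := by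
    ext c
    simp only [SetLike.mem_coe, Ideal.mem_span_pair, Set.mem_range, Prod.exists]
  rw [h]
  exact (isCompact_range (by fun_prop)).isClosed

/-- The augmentation ideal of `Λ` is generated by `1 - a₂` and `a₁ - 1`. -/
theorem exists_of_augmentation_eq_zero (hx : Generates x) {b : Lam} (hb : augmentation b = 0) :
    ∃ r s : Lam, r * (1 - grp (ab (x 1))) + s * (grp (ab (x 0)) - 1) = b := by
  let J : Ideal Lam := Ideal.span {1 - grp (ab (x 1)), grp (ab (x 0)) - 1}
  suffices b ∈ J from Ideal.mem_span_pair.mp this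
  have hJ : IsClosed (J : Set Lam) := isClosed_span_pair _ _
  -- the elements `g` with `ab g ≡ 1` modulo `J` form a closed subgroup containing `x₁, x₂`
  let H : Subgroup Mhat :=
    { carrier := {g | grp (ab g) - 1 ∈ J}
      one_mem' := by simp
      mul_mem' := fun {g h} hg hh => by
        have := J.add_mem (J.mul_mem_left (grp (ab g)) hh) hg
        rwa [mul_sub, mul_one, sub_add_sub_cancel, ← map_mul, ← map_mul] at this
      inv_mem' := fun {g} hg => by
        have := J.neg_mem (J.mul_mem_left (grp (ab g⁻¹)) hg)
        rwa [mul_sub, mul_one, ← map_mul, ← map_mul, inv_mul_cancel, map_one, map_one,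
          neg_sub] at this }
  have hH : (H : Set Mhat) = (fun g => grp (ab g) - 1) ⁻¹' (J : Set Lam) := rfl
  have hHc : IsClosed (H : Set Mhat) :=
    hH ▸ hJ.preimage ((continuous_grp.comp continuous_ab).sub continuous_const)
  have hHx : Subgroup.closure (Set.range x) ≤ H := by
    rw [Subgroup.closure_le]
    rintro _ ⟨i, rfl⟩
    change grp (ab (x i)) - 1 ∈ J
    fin_cases i
    · exact Ideal.subset_span (by simp)
    · rw [← neg_sub]
      exact J.neg_mem (Ideal.subset_span (by simp))
  have hHtop := Subgroup.topologicalClosure_minimal _ hHx hHc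
  rw [hx] at hHtop
  refine mem_of_augmentation_eq_zero hJ (fun a => ?_) hb
  obtain ⟨g, rfl⟩ : ∃ g, ab g = a := QuotientGroup.mk_surjective a
  exact hHtop (Subgroup.mem_top g)

theorem augmentation_bachmuthDet_gamma (r : Fin 2 → Lam) :
    augmentation (bachmuthDet hx (gamma hx r)) = 1 := by
  rw [bachmuthDet_gamma]
  simp [augmentation_grp]

end Basis

end ProMetabelian

open ProMetabelian
theorem mainTheorem4 (x : Fin 2 → Mhat) (hx : Generates x) :
    (∀ r : Fin 2 → Lam,
      bachmuthDet hx (gamma hx r) =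
        1 + r 0 * (1 - grp (ab (x 1))) + r 1 * (grp (ab (x 0)) - 1)) ∧
    (∀ r : Fin 2 → Lam,
      IsAutomorphism (gamma hx r).1 ↔ bachmuthDet hx (gamma hx r) ∈ specialUnits) ∧
    Set.range (fun r : Fin 2 → Lam => bachmuthDet hx (gamma hx r)) = specialElements := by
  refine ⟨bachmuthDet_gamma hx, fun r => ⟨fun h => ⟨isUnit_bachmuthDet hx h,
    augmentation_bachmuthDet_gamma hx r⟩, fun h => isAutomorphism_gamma hx h.1⟩, ?_⟩
  refine Set.Subset.antisymm ?_ fun b hb => ?_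
  · rintro _ ⟨r, rfl⟩
    exact augmentation_bachmuthDet_gamma hx r
  · obtain ⟨r, s, h⟩ := exists_of_augmentation_eq_zero hx (b := b - 1) (by
      rw [map_sub, map_one, hb, sub_self])
    refine ⟨![r, s], (bachmuthDet_gamma hx _).trans ?_⟩
    rw [Matrix.cons_val_zero, Matrix.cons_val_one, add_assoc]
    exact add_eq_of_eq_sub' h
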